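/- Let $n\in\mathbb N$ and $\theta_*>0$. There is a constant $C>0$, depending only on $n$ and $\theta_*$, such that the following holds for every set $\mathcal X$ (the data), every finite set $\mathcal Y$ (the classes) and every surjective labelling $h:\mathcal X\to\mathcal Y$. For $f:\mathcal X\to\mathbb R^n$ and $i\in\mathcal Y$ put $X_f^i=\{f(x) : x\in\mathcal X,\ h(x)=i\}$. The function $f$ is called Triplet-Separated if $\|x-y\|\le\|x-z\|$ for all $i\ne j$ in $\mathcal Y$, all $x,y\in X_f^i$ and all $z\in X_f^j$; let $\mathcal F_{TS}$ be the set of all Triplet-Separated functions. Put $$d_{\rm haus}(f,g)=\max_{i\in\mathcal Y} d_H(X_f^i,X_g^i),\qquad d_{\rm haus}(f,\mathcal F_{TS})=\inf_{g\in\mathcal F_{TS}}d_{\rm haus}(f,g),$$ where $d_H$ is the Hausdorff distance with values in $[0,\infty]$. The Triplet Loss (with margin $0$) sampled by hard negative mining is $$\mathcal L(f)=\sup\bigl\{\max(\|f(x)-f(x^+)\|-\|f(x)-f(x^-)\|,\,0) : x,x^+,x^-\in\mathcal X,\ h(x^+)=h(x)\ne h(x^-)\bigr\},$$ which is $0$ if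 there are no such triplets. The thickness of a bounded set $A\subset\mathbb R^n$ is $\theta(A)=\inf_{\|e\|=1}\operatorname{diam}\{x\cdot e : x\in A\}$. Let $\mathcal T$ be the set of all $f:\mathcal X\to\mathbb R^n$ such that $f(\mathcal X)$ is bounded and $\theta(f(\mathcal X))\ge\theta_*$. 1. For every $f\in\mathcal T$, $$\mathcal L(f)\le C\,d_{\rm haus}(f,\mathcal F_{TS})\qquad\text{and}\qquad d_{\rm haus}(f,\mathcal F_{TS})\le C\,\mathcal L(f).$$ 2. Consequently the optima over any family $F\subseteq\mathcal T$ agree up to a constant factor: $\inf_{F}\mathcal L\le C\inf_{g\in F}d_{\rm haus}(g,\mathcal F_{TS})$ and $\inf_{g\in F}d_{\rm haus}(g,\mathcal F_{TS})\le C\inf_F\mathcal L$; every $f\in F$ that minimizes $\mathcal L$ over $F$ satisfies $d_{\rm haus}(f,\mathcal F_{TS})\le C\inf_{g\in F}d_{\rm haus}(g,\mathcal F_{TS})$; and every $f\in F$ that minimizes $d_{\rm haus}(\cdot,\mathcal F_{TS})$ over $F$ satisfies $\mathcal L(f)\le C\inf_{g\in F}\mathcal L(g)$. -/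

import Mathlib

open scoped NNReal ENNReal

noncomputable section

/-- The projection of a set `A` on the line spanned by `e`, that is `{x · e | x ∈ A}`. -/
def projOn {n : ℕ} (e : EuclideanSpace ℝ (Fin n)) (A : Set (EuclideanSpace ℝ (Fin n))) : Set ℝ :=
  (fun x => inner ℝ x e) '' A

/-- The thickness of a bounded set `A ⊆ ℝⁿ`: the infimum, over all unit vectors `e`, of the
diameter of the projection of `A` on the line spanned by `e`. -/
def thickness {n : ℕ} (A : Set (EuclideanSpace ℝ (Fin n))) : ℝ :=
  ⨅ e : Metric.sphere (0 : EuclideanSpace ℝ (Fin n)) 1, Metric.diam (projOn e.1 A)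

section Embeddings

variable {X Y : Type*} {n : ℕ}

/-- The embedding subset of class `i`: the image under `f` of the points with label `i`. -/
def classImage (h : X → Y) (f : X → EuclideanSpace ℝ (Fin n)) (i : Y) :
    Set (EuclideanSpace ℝ (Fin n)) :=
  {p | ∃ x, h x = i ∧ f x = p}

/-- A family of subsets of `ℝⁿ` is Triplet-Separated if its members are non-empty and every point
of one member is at most as far from the points of that member as from those of any other. -/
def TripletSeparated (A : Y → Set (EuclideanSpace ℝ (Fin n))) : Prop :=
  (∀ i, (A i).Nonempty) ∧
    ∀ i j, i ≠ j → ∀ x ∈ A i, ∀ y ∈ A i, ∀ z ∈ A j, dist x y ≤ dist x z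

/-- The set of all Triplet-Separated functions `X → ℝⁿ`. -/
def tripletSeparatedFunctions (h : X → Y) (n : ℕ) : Set (X → EuclideanSpace ℝ (Fin n)) :=
  {f | TripletSeparated (classImage h f)}

/-- The Triplet Loss (with zero margin) of an anchor `x`, a positive `xp` and a negative `xn`. -/
def tripletLoss (f : X → EuclideanSpace ℝ (Fin n)) (x xp xn : X) : ℝ :=
  max (dist (f x) (f xp) - dist (f x) (f xn)) 0

/-- The Triplet Loss sampled by hard negative mining: the largest Triplet Loss of all triplets of
an anchor, a positive of the same class and a negative of another class. It is `0` if there are no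
triplets, that is if there is only one class. -/
def hardTripletLoss (h : X → Y) (f : X → EuclideanSpace ℝ (Fin n)) : ℝ≥0∞ :=
  ⨆ (x : X) (xp : X) (xn : X) (_ : h x = h xp) (_ : h x ≠ h xn),
    ENNReal.ofReal (tripletLoss f x xp xn)

/-- The Hausdorff-like distance of two functions: the largest Hausdorff distance of the embedding
subsets of the same class. It takes values in `[0, ∞]`, as functions may be unbounded. -/
def dHaus (h : X → Y) (f g : X → EuclideanSpace ℝ (Fin n)) : ℝ≥0∞ :=
  ⨆ i : Y, Metric.hausdorffEDist (classImage h f i) (classImage h g i)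

/-- The Hausdorff-like distance of a function from the set of Triplet-Separated functions. -/
def dHausTS (h : X → Y) (f : X → EuclideanSpace ℝ (Fin n)) : ℝ≥0∞ :=
  ⨅ g ∈ tripletSeparatedFunctions h n, dHaus h f g

/-- The embeddings with bounded image and thickness at least `θ`. -/
def thickEmbeddings (X : Type*) (n : ℕ) (θ : ℝ) : Set (X → EuclideanSpace ℝ (Fin n)) :=
  {f | Bornology.IsBounded (Set.range f) ∧ θ ≤ thickness (Set.range f)}

end Embeddings

end

/-!
Write `ε` for the Triplet Loss of `f`. Three points of `f` that are moved by `δ` each change a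
Triplet Loss by at most `4 * δ`, whence `ε ≤ 4 * dHausTS h f`. The converse is the substance: a
Triplet-Separated `g` has to be found whose classes are within `C * ε` of those of `f`.

Put `N = n + 2`. Every class `A` has a centre `c` and a radius `ρ`, namely those of its smallest
enclosing ball, obtained from a probability measure on `A` of maximal variance `ρ ^ 2`
(`exists_isVarianceCenter`). A class of radius below `600 * N ^ 2 * ε` collapses to one of its own
points; a larger one shrinks towards `c` by the factor `1 - 16 * N * ε / ρ`, so that its points move
by at most `16 * N * ε`. Shrinking relaxes the constraints on the class by an amount of order `ε`,
but the points of the other classes move too. That the gain wins (`gain_sub_loss_ge`) is seen as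
follows.

Let `x` be a point of a shrinking class with centre `c` and radius `ρ`, let `z` be a point of another
one with centre `d` and radius `σ`, and let `R = ‖x - z‖`. To first order, and up to the factor
`16 * N * ε / (2 * R)`, the gain is `(R ^ 2 + ‖z - c‖ ^ 2 - ‖x - c‖ ^ 2) / ρ` and the loss is
`(R ^ 2 + ‖z - d‖ ^ 2 - ‖x - d‖ ^ 2) / σ`. The triplets with anchor `x` give
`R ^ 2 ≥ ρ ^ 2 + ‖x - c‖ ^ 2`, and those with anchors in the class of `x` give
`‖z - c‖ ^ 2 ≥ (1 + 1 / N) * ρ ^ 2`, both up to errors that are small against `ρ ^ 2 / N`. Hence the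
gain is at least `max (2 * ρ) (R ^ 2 / ρ) + ρ / N`. The same triplets bound the loss by `2 * σ`, as
only nearly tight constraints matter, and those with anchors in the class of `z` bound it by
`R ^ 2 / σ`. One of these bounds is at most the corresponding part of the gain, according as
`σ ≤ ρ` or not, and the surplus `ρ / N` absorbs all errors. It comes from Carathéodory's theorem: a
measure with at most `N` atoms does not vanish on the diagonal (`variance_le_of_mem_convexHull`).
-/

/-! ### Variance centres of bounded sets -/

section Center

open scoped RealInnerProductSpace

variable {E : Type*} [NormedAddCommGroup E] [InnerProductSpace ℝ E]

/-- The lift of `A` to the paraboloid over `E`. A point `(c, q)` of its convex hull records the mean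
and the second moment of a finitely supported probability measure on `A`, so that `q - ‖c‖ ^ 2` is
the variance of that measure. -/
def paraboloidLift (A : Set E) : Set (E × ℝ) :=
  (fun y => (y, ‖y‖ ^ 2)) '' A

lemma norm_sub_sq_paraboloid (v c : E) (q : ℝ) :
    ‖v - c‖ ^ 2 + (q - ‖c‖ ^ 2) = ‖v‖ ^ 2 - 2 * ⟪v, c⟫ + q := by
  rw [norm_sub_sq_real]; ring

/-- If every squared distance from `v` to a point of `A` is at least `T`, then so is its mean under
any limit of probability measures on `A`. -/
lemma le_of_mem_closure_convexHull_paraboloidLift {A : Set E} {p : E × ℝ}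
    (hp : p ∈ closure (convexHull ℝ (paraboloidLift A))) {v : E} {T : ℝ}
    (hT : ∀ y ∈ A, T ≤ ‖v - y‖ ^ 2) : T ≤ ‖v - p.1‖ ^ 2 + (p.2 - ‖p.1‖ ^ 2) := by
  rw [norm_sub_sq_paraboloid]
  have hconv : Convex ℝ {p : E × ℝ | T ≤ ‖v‖ ^ 2 - 2 * ⟪v, p.1⟫ + p.2} := by
    intro a ha b hb s t hs ht hst
    simp only [Set.mem_ofPred_eq, Prod.fst_add, Prod.smul_fst, Prod.snd_add, Prod.smul_snd,
      inner_add_right, inner_smul_right, smul_eq_mul] at *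
    obtain rfl : t = 1 - s := by linarith
    nlinarith [mul_le_mul_of_nonneg_left ha hs, mul_le_mul_of_nonneg_left hb ht]
  have hclosed : IsClosed {p : E × ℝ | T ≤ ‖v‖ ^ 2 - 2 * ⟪v, p.1⟫ + p.2} :=
    isClosed_le (by fun_prop) (by fun_prop)
  refine closure_minimal (convexHull_min ?_ hconv) hclosed hp
  rintro _ ⟨y, hy, rfl⟩
  have := hT y hy
  rw [norm_sub_sq_real] at this
  exact this

lemma ge_of_mem_closure_convexHull_paraboloidLift {A : Set E} {p : E × ℝ}
    (hp : p ∈ closure (convexHull ℝ (paraboloidLift A))) {v : E} {T : ℝ}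
    (hT : ∀ y ∈ A, ‖v - y‖ ^ 2 ≤ T) : ‖v - p.1‖ ^ 2 + (p.2 - ‖p.1‖ ^ 2) ≤ T := by
  rw [norm_sub_sq_paraboloid]
  have hconv : Convex ℝ {p : E × ℝ | ‖v‖ ^ 2 - 2 * ⟪v, p.1⟫ + p.2 ≤ T} := by
    intro a ha b hb s t hs ht hst
    simp only [Set.mem_ofPred_eq, Prod.fst_add, Prod.smul_fst, Prod.snd_add, Prod.smul_snd,
      inner_add_right, inner_smul_right, smul_eq_mul] at *
    obtain rfl : t = 1 - s := by linarith
    nlinarith [mul_le_mul_of_nonneg_left ha hs, mul_le_mul_of_nonneg_left hb ht]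
  have hclosed : IsClosed {p : E × ℝ | ‖v‖ ^ 2 - 2 * ⟪v, p.1⟫ + p.2 ≤ T} :=
    isClosed_le (by fun_prop) (by fun_prop)
  refine closure_minimal (convexHull_min ?_ hconv) hclosed hp
  rintro _ ⟨y, hy, rfl⟩
  have := hT y hy
  rw [norm_sub_sq_real] at this
  exact this

/-- A point `v` which is, up to `ε`, as far from each point `y` of `A` as any other point of `A` is
from `y` keeps a distance from the mean of a measure on `A` that exceeds the standard deviation by
a factor depending on the dimension only. By Carathéodory's theorem the measure has at most
`finrank ℝ E + 2` atoms; the gain comes from the fact that an atom has distance `0` to itself. -/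
lemma variance_le_of_mem_convexHull [FiniteDimensional ℝ E] {A : Set E} {p : E × ℝ}
    (hp : p ∈ convexHull ℝ (paraboloidLift A)) {v : E} {ε D : ℝ} (hε : 0 ≤ ε)
    (hD : ∀ y ∈ A, ∀ y' ∈ A, ‖y - y'‖ ≤ D)
    (hv : ∀ y ∈ A, ∀ y' ∈ A, ‖y - y'‖ ≤ ‖v - y‖ + ε) :
    (1 + 1 / (Module.finrank ℝ E + 2 : ℝ)) * (p.2 - ‖p.1‖ ^ 2) ≤ ‖v - p.1‖ ^ 2 + 2 * ε * D := by
  classical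
  obtain ⟨ι, _, z, w, hz, hind, hw, hw1, hsum⟩ := eq_pos_convex_span_of_mem_convexHull hp
  have hcard : (Fintype.card ι : ℝ) ≤ Module.finrank ℝ E + 2 := by
    have := hind.card_le_finrank_succ
    have h2 := Submodule.finrank_le (vectorSpan ℝ (Set.range z))
    rw [Module.finrank_prod, Module.finrank_self] at h2
    exact_mod_cast (by omega : Fintype.card ι ≤ Module.finrank ℝ E + 2)
  have hz' : ∀ i, ∃ y ∈ A, (y, ‖y‖ ^ 2) = z i := fun i => hz ⟨i, rfl⟩
  choose y hyA hyz using hz'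
  set c := p.1 with hc
  set V := p.2 - ‖c‖ ^ 2 with hV
  have hmean : ∑ i, w i • y i = c := by
    rw [hc, ← hsum, Prod.fst_sum]
    exact Finset.sum_congr rfl fun i _ => by simp [← hyz i]
  have hsq : ∑ i, w i * ‖y i‖ ^ 2 = p.2 := by
    rw [← hsum, Prod.snd_sum]
    exact Finset.sum_congr rfl fun i _ => by simp [← hyz i]
  have hident : ∀ u : E, ∑ i, w i * ‖u - y i‖ ^ 2 = ‖u - c‖ ^ 2 + V := by
    intro u
    rw [hV, norm_sub_sq_paraboloid, ← hsq, ← hmean, inner_sum]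
    simp only [norm_sub_sq_real, inner_smul_right, mul_add, mul_sub, Finset.sum_add_distrib,
      Finset.sum_sub_distrib, ← Finset.sum_mul, hw1, one_mul, Finset.mul_sum]
    congr 2
    exact Finset.sum_congr rfl fun i _ => by ring
  have hV0 : 0 ≤ V := by
    have := hident c
    rw [sub_self, norm_zero] at this
    have h0 : 0 ≤ ∑ i, w i * ‖c - y i‖ ^ 2 :=
      Finset.sum_nonneg fun i _ => mul_nonneg (hw i).le (sq_nonneg _)
    linarith
  have hpair : ∀ k l, ‖y k - y l‖ ^ 2 ≤ ‖v - y k‖ ^ 2 + 2 * ε * D := by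
    intro k l
    have h1 := hv _ (hyA k) _ (hyA l)
    have h2 := hD _ (hyA k) _ (hyA l)
    have h3 := norm_nonneg (y k - y l)
    have h4 := norm_nonneg (v - y k)
    by_cases h : ‖y k - y l‖ ≤ ε
    · nlinarith [mul_nonneg hε (h3.trans h2)]
    · nlinarith [mul_le_mul_of_nonneg_left h2 hε]
  have hatom : ∀ k, (1 + w k) * V ≤ ‖v - y k‖ ^ 2 + 2 * ε * D - ‖y k - c‖ ^ 2 := by
    intro k
    set a := ‖v - y k‖ ^ 2 + 2 * ε * D with ha
    have h1 : ∑ l, w l * ‖y k - y l‖ ^ 2 ≤ ∑ l, (w l * a - if l = k then w k * a else 0) := by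
      refine Finset.sum_le_sum fun l _ => ?_
      split_ifs with h
      · simp [h]
      · rw [sub_zero]
        exact mul_le_mul_of_nonneg_left (hpair k l) (hw l).le
    rw [hident, Finset.sum_sub_distrib, ← Finset.sum_mul, hw1] at h1
    simp only [Finset.sum_ite_eq', Finset.mem_univ, if_true] at h1
    have hwk := (hw k).le
    have h5 := sq_nonneg ‖y k - c‖
    have ha' : V ≤ a := by nlinarith [hpair k k, mul_nonneg hwk ((sq_nonneg _).trans (hpair k k))]
    nlinarith [mul_le_mul_of_nonneg_left ha' hwk]
  have hsumatom : ∑ k, w k * ((1 + w k) * V) ≤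
      ∑ k, w k * (‖v - y k‖ ^ 2 + 2 * ε * D - ‖y k - c‖ ^ 2) :=
    Finset.sum_le_sum fun k _ => mul_le_mul_of_nonneg_left (hatom k) (hw k).le
  have hr : ∑ k, w k * (‖v - y k‖ ^ 2 + 2 * ε * D - ‖y k - c‖ ^ 2) =
      ‖v - c‖ ^ 2 + 2 * ε * D := by
    have h1 := hident v
    have h2 := hident c
    simp only [norm_sub_rev c] at h2
    rw [sub_self, norm_zero] at h2
    simp only [mul_add, mul_sub, Finset.sum_add_distrib, Finset.sum_sub_distrib,
      ← Finset.sum_mul, hw1, h1, h2]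
    ring
  have hl : ∑ k, w k * ((1 + w k) * V) = (1 + ∑ k, w k ^ 2) * V := by
    rw [← hw1, ← Finset.sum_add_distrib, Finset.sum_mul]
    simp only [hw1]
    exact Finset.sum_congr rfl fun i _ => by ring
  have hcs : 1 / (Module.finrank ℝ E + 2 : ℝ) ≤ ∑ k, w k ^ 2 := by
    have h1 : (∑ k, w k) ^ 2 ≤ _ := sq_sum_le_card_mul_sum_sq
    rw [hw1, Finset.card_univ] at h1
    rw [div_le_iff₀ (by positivity)]
    have h2 : 0 ≤ ∑ k, w k ^ 2 := Finset.sum_nonneg fun i _ => sq_nonneg _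
    nlinarith
  nlinarith [mul_le_mul_of_nonneg_right hcs hV0]

/-- `c` and `ρ` are the centre and the radius of the smallest ball containing `A`, and `c` is the
mean of a limit of probability measures on `A` of variance `ρ ^ 2`: the mean under it of the squared
distance from `v` is `‖v - c‖ ^ 2 + ρ ^ 2`, which `le_of_forall_le` and `ge_of_forall_ge` compare with
the extreme values on `A`. The last field says that a point `v` which is, up to `ε`, as far from each
point `y` of `A` as any other point of `A` is from `y` has distance at least about `√(1 + κ) * ρ`
from `c`. -/
structure IsVarianceCenter (κ : ℝ) (A : Set E) (c : E) (ρ : ℝ) : Prop where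
  radius_nonneg : 0 ≤ ρ
  norm_sub_le : ∀ y ∈ A, ‖y - c‖ ≤ ρ
  le_of_forall_le : ∀ v T, (∀ y ∈ A, T ≤ ‖v - y‖ ^ 2) → T ≤ ‖v - c‖ ^ 2 + ρ ^ 2
  ge_of_forall_ge : ∀ v T, (∀ y ∈ A, ‖v - y‖ ^ 2 ≤ T) → ‖v - c‖ ^ 2 + ρ ^ 2 ≤ T
  radius_sq_le : ∀ v ε, 0 ≤ ε → (∀ y ∈ A, ∀ y' ∈ A, ‖y - y'‖ ≤ ‖v - y‖ + ε) →
    (1 + κ) * ρ ^ 2 ≤ ‖v - c‖ ^ 2 + 4 * ε * ρ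

/-- Every bounded non-empty set has a variance centre: the mean of a limit of probability measures
on it of maximal variance. -/
lemma exists_isVarianceCenter [FiniteDimensional ℝ E] {A : Set E} (hA : A.Nonempty)
    (hb : Bornology.IsBounded A) :
    ∃ c ρ, IsVarianceCenter (1 / (Module.finrank ℝ E + 2 : ℝ)) A c ρ := by
  set K := closure (convexHull ℝ (paraboloidLift A)) with hK
  have hKc : IsCompact K := by
    refine Metric.isCompact_of_isClosed_isBounded isClosed_closure ?_
    rw [hK, Metric.isBounded_closure_iff, isBounded_convexHull]
    obtain ⟨R, hR⟩ := hb.exists_norm_le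
    refine isBounded_iff_forall_norm_le.2 ⟨max R (R ^ 2), ?_⟩
    rintro _ ⟨y, hy, rfl⟩
    rw [Prod.norm_mk]
    refine max_le_max (hR y hy) ?_
    rw [norm_pow, norm_norm]
    exact pow_le_pow_left₀ (norm_nonneg _) (hR y hy) 2
  have hKconv : Convex ℝ K := (convex_convexHull ℝ _).closure
  have hAK : ∀ y ∈ A, ((y, ‖y‖ ^ 2) : E × ℝ) ∈ K := fun y hy =>
    subset_closure (subset_convexHull ℝ _ ⟨y, hy, rfl⟩)
  obtain ⟨y₀, hy₀⟩ := hA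
  obtain ⟨p, hpK, hmax⟩ := hKc.exists_isMaxOn ⟨_, hAK y₀ hy₀⟩
    (f := fun p : E × ℝ => p.2 - ‖p.1‖ ^ 2) (by fun_prop)
  have hV0 : 0 ≤ p.2 - ‖p.1‖ ^ 2 := by simpa using hmax (hAK y₀ hy₀)
  set ρ := √(p.2 - ‖p.1‖ ^ 2) with hρ
  have hρ2 : ρ ^ 2 = p.2 - ‖p.1‖ ^ 2 := Real.sq_sqrt hV0
  have hρ0 : 0 ≤ ρ := Real.sqrt_nonneg _
  have hrad : ∀ y ∈ A, ‖y - p.1‖ ≤ ρ := by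
    intro y hy
    refine abs_le_of_sq_le_sq' ?_ hρ0 |>.2
    rw [hρ2]
    by_contra! hlt
    set d := ‖y - p.1‖ ^ 2 with hd
    have hdpos : 0 < d := hV0.trans_lt hlt
    -- Mixing a small mass `t` at `y` into the maximizer would increase the variance.
    set t := (d - (p.2 - ‖p.1‖ ^ 2)) / (2 * d) with ht
    have htd : t * d = (d - (p.2 - ‖p.1‖ ^ 2)) / 2 := by rw [ht]; field_simp
    have ht0 : 0 < t := div_pos (by linarith) (by linarith)
    have ht1 : t ≤ 1 := by rw [ht, div_le_one (by linarith)]; linarith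
    have hmem := hKconv.add_smul_sub_mem hpK (hAK y hy) ⟨ht0.le, ht1⟩
    have hle := hmax hmem
    simp only [Set.mem_ofPred_eq, Prod.fst_add, Prod.smul_fst, Prod.fst_sub, Prod.snd_add,
      Prod.smul_snd, Prod.snd_sub, smul_eq_mul] at hle
    rw [norm_add_sq_real, norm_smul, inner_smul_right, mul_pow, Real.norm_eq_abs, sq_abs, ← hd,
      inner_sub_right, real_inner_self_eq_norm_sq] at hle
    have hd' := norm_sub_sq_real y p.1
    rw [← hd, real_inner_comm] at hd'
    have h5 : t * (d - (p.2 - ‖p.1‖ ^ 2)) ≤ t * (t * d) := by nlinarith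
    have h6 := le_of_mul_le_mul_left h5 ht0
    linarith
  refine ⟨p.1, ρ, hρ0, hrad, ?_, ?_, ?_⟩
  · intro v T hT
    rw [hρ2]
    exact le_of_mem_closure_convexHull_paraboloidLift hpK hT
  · intro v T hT
    rw [hρ2]
    exact ge_of_mem_closure_convexHull_paraboloidLift hpK hT
  · intro v ε hε hv
    have hD : ∀ y ∈ A, ∀ y' ∈ A, ‖y - y'‖ ≤ 2 * ρ := by
      intro y hy y' hy'
      have h1 := norm_sub_le_norm_sub_add_norm_sub y p.1 y'
      have h2 := hrad y hy
      have h3 := hrad y' hy'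
      rw [norm_sub_rev] at h3
      linarith
    have hclosed : IsClosed {p : E × ℝ | (1 + 1 / (Module.finrank ℝ E + 2 : ℝ)) *
        (p.2 - ‖p.1‖ ^ 2) ≤ ‖v - p.1‖ ^ 2 + 2 * ε * (2 * ρ)} :=
      isClosed_le (by fun_prop) (by fun_prop)
    have hle : (1 + 1 / (Module.finrank ℝ E + 2 : ℝ)) * (p.2 - ‖p.1‖ ^ 2) ≤
        ‖v - p.1‖ ^ 2 + 2 * ε * (2 * ρ) :=
      closure_minimal (fun p hp => variance_le_of_mem_convexHull hp hε hD hv) hclosed hpK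
    rw [hρ2]
    linarith

end Center

/-! ### Shrinking a class separates it from the others -/

section Shrinking

open scoped RealInnerProductSpace

variable {E : Type*} [NormedAddCommGroup E]

/-- The competition between the gain from shrinking a class of radius `ρ` and the loss `L` from
moving a point of another class, with `R` the distance of the two points, `a` and `b` the squared
distances of the foreign and the own point from the centre of the shrinking class. -/
lemma gain_sub_loss_ge {N ε ρ R a b L : ℝ} (hN : 2 ≤ N) (hε : 0 < ε)
    (hρ : 600 * N ^ 2 * ε ≤ ρ) (hR0 : 0 ≤ R) (hR : R ≤ 4 * ρ)
    (hb : b + ρ ^ 2 ≤ (R + ε) ^ 2) (hbρ : b ≤ ρ ^ 2)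
    (ha : (1 + 1 / N) * ρ ^ 2 ≤ a + 4 * ε * ρ)
    (hL : L ≤ 16 * N * ε * (2 * ρ + 9 / 20 * (ρ / N)) ∨
      L ≤ 16 * N * ε * (R ^ 2 / ρ + 4 * ε)) :
    2 * R * ε ≤ 16 * N * ε / ρ * (R ^ 2 + a - b) - L := by
  have hN0 : 0 < N := by linarith
  have hρ0 : 0 < ρ := lt_of_lt_of_le (by positivity) hρ
  set η := ρ / N with hη
  have hηN : N * η = ρ := by rw [hη]; field_simp
  have hη0 : 0 < η := div_pos hρ0 hN0
  -- The errors of order `ε` are small against `ρ / N`.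
  have hεη : 1200 * ε ≤ η := by
    rw [hη, le_div_iff₀ hN0]
    nlinarith [mul_pos hε hN0]
  have hερ : ε ≤ ρ := by nlinarith
  have ha' : ρ ^ 2 + η * ρ ≤ a + 4 * ε * ρ := by
    have : (1 + 1 / N) * ρ ^ 2 = ρ ^ 2 + η * ρ := by rw [hη]; field_simp
    linarith
  have hdiv : ∀ u v : ℝ, v * ρ ≤ u → v ≤ u / ρ := fun u v h => (le_div_iff₀ hρ0).2 h
  have hg : 16 * N * ε / ρ * (R ^ 2 + a - b) = 16 * N * ε * ((R ^ 2 + a - b) / ρ) := by ring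
  have hK : 0 < 16 * N * ε := by positivity
  have hneed : 2 * R * ε ≤ 16 * N * ε * (η / 2) := by
    nlinarith [mul_le_mul_of_nonneg_right hR hε.le]
  rw [hg]
  rcases hL with hL | hL
  · have h1 : 2 * ρ + η - 13 * ε ≤ (R ^ 2 + a - b) / ρ := by
      apply hdiv
      nlinarith [mul_le_mul_of_nonneg_right hR hε.le, mul_le_mul_of_nonneg_right hερ hε.le]
    nlinarith [mul_le_mul_of_nonneg_left h1 hK.le, mul_le_mul_of_nonneg_left hεη hK.le]
  · have h1 : R ^ 2 / ρ + η - 13 * ε ≤ (R ^ 2 + a - b) / ρ := by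
      apply hdiv
      have : R ^ 2 / ρ * ρ = R ^ 2 := by field_simp
      nlinarith [mul_pos hε hρ0]
    nlinarith [mul_le_mul_of_nonneg_left h1 hK.le, mul_le_mul_of_nonneg_left hεη hK.le]

/-- The loss from moving a point `z` of `B` as it does when `B` is shrunk. Both bounds on the factor
`R ^ 2 + ‖z - d‖ ^ 2 - ‖x - d‖ ^ 2` hold whichever class is larger; one is used if the radius `σ` of
`B` is at most `ρ` and the other if it is not. -/
lemma loss_le {N ε : ℝ} (hN : 2 ≤ N) (hε : 0 < ε) {A B : Set E} {d x z : E} {ρ s : ℝ}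
    (hρ : 600 * N ^ 2 * ε ≤ ρ)
    (hs : s = 0 ∨
      ∃ σ, IsVarianceCenter (1 / N) B d σ ∧ 600 * N ^ 2 * ε ≤ σ ∧ s = 16 * N * ε / σ)
    (hBA : ∀ x ∈ B, ∀ y ∈ B, ∀ z ∈ A, ‖x - y‖ ≤ ‖x - z‖ + ε)
    (hx : x ∈ A) (hz : z ∈ B) (hR4 : ‖x - z‖ ≤ 4 * ρ)
    (hfar : ∀ z' ∈ B, ‖x - z‖ ≤ ‖x - z'‖ + (2 * (16 * N * ε) + ε)) :
    s * (‖x - z‖ ^ 2 + ‖z - d‖ ^ 2 - ‖x - d‖ ^ 2) ≤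
        16 * N * ε * (2 * ρ + 9 / 20 * (ρ / N)) ∨
      s * (‖x - z‖ ^ 2 + ‖z - d‖ ^ 2 - ‖x - d‖ ^ 2) ≤
        16 * N * ε * (‖x - z‖ ^ 2 / ρ + 4 * ε) := by
  have hN0 : 0 < N := by linarith
  have hMpos : 0 < 600 * N ^ 2 * ε := by positivity
  have hρ0 : 0 < ρ := hMpos.trans_le hρ
  set K := 16 * N * ε with hK
  have hK0 : 0 < K := by positivity
  set R := ‖x - z‖ with hR
  have hR0 : 0 ≤ R := norm_nonneg _
  rcases hs with rfl | ⟨σ, hB, hσ, hsσ⟩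
  · left
    rw [zero_mul]
    positivity
  have hσ0 : 0 < σ := hMpos.trans_le hσ
  have hs' : ∀ u : ℝ, s * u = K * (u / σ) := fun u => by rw [hsσ]; ring
  rw [hs']
  rcases le_total σ ρ with hσρ | hσρ
  · left
    refine mul_le_mul_of_nonneg_left ?_ hK0.le
    rw [div_le_iff₀ hσ0]
    -- As `‖x - y‖` is close to `R`, all of `B` is nearly as far from `x` as `z` is.
    have h1 : R ^ 2 - 2 * R * (2 * K + ε) ≤ ‖x - d‖ ^ 2 + σ ^ 2 := by
      refine hB.le_of_forall_le x _ fun z' hz' => ?_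
      have h2 := hfar z' hz'
      have h3 := norm_nonneg (x - z')
      by_cases h4 : R ≤ 2 * K + ε
      · nlinarith [sq_nonneg ‖x - z'‖, mul_le_mul_of_nonneg_left h4 hR0]
      · push Not at h4
        have h5 : (R - (2 * K + ε)) ^ 2 ≤ ‖x - z'‖ ^ 2 :=
          pow_le_pow_left₀ (by linarith) (by linarith) 2
        nlinarith [sq_nonneg (2 * K + ε)]
    have h2 : ‖z - d‖ ^ 2 ≤ σ ^ 2 := pow_le_pow_left₀ (norm_nonneg _) (hB.norm_sub_le z hz) 2
    have h3 : 2 * R * (2 * K + ε) ≤ 9 / 20 * (ρ / N) * σ := by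
      have h4 : 2 * K + ε ≤ 65 / 2 * (N * ε) := by rw [hK]; nlinarith
      have h5 : 9 / 20 * (ρ / N) * (600 * N ^ 2 * ε) = 8 * ρ * (135 / 4 * (N * ε)) := by
        field_simp; norm_num
      have h6 : 9 / 20 * (ρ / N) * (600 * N ^ 2 * ε) ≤ 9 / 20 * (ρ / N) * σ :=
        mul_le_mul_of_nonneg_left hσ (by positivity)
      have h7 : 2 * R * (2 * K + ε) ≤ 8 * ρ * (65 / 2 * (N * ε)) :=
        mul_le_mul (by linarith) h4 (by positivity) (by positivity)
      have h8 : 0 ≤ ρ * (N * ε) := by positivity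
      linarith
    have h4 : σ * σ ≤ ρ * σ := mul_le_mul_of_nonneg_right hσρ hσ0.le
    linarith [sq σ]
  · right
    refine mul_le_mul_of_nonneg_left ?_ hK0.le
    have h1 : (1 + 1 / N) * σ ^ 2 ≤ ‖x - d‖ ^ 2 + 4 * ε * σ :=
      hB.radius_sq_le x ε hε.le fun w hw w' hw' => by
        rw [norm_sub_rev x]; exact hBA w hw w' hw' x hx
    have h2 : ‖z - d‖ ^ 2 ≤ σ ^ 2 := pow_le_pow_left₀ (norm_nonneg _) (hB.norm_sub_le z hz) 2
    have h3 : 0 ≤ 1 / N * σ ^ 2 := by positivity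
    have h4 : R ^ 2 / σ ≤ R ^ 2 / ρ := div_le_div_of_nonneg_left (sq_nonneg _) hρ0 hσρ
    have h5 : (R ^ 2 + ‖z - d‖ ^ 2 - ‖x - d‖ ^ 2) / σ ≤ R ^ 2 / σ + 4 * ε := by
      rw [div_add' _ _ _ hσ0.ne']
      exact div_le_div_of_nonneg_right (by linarith) hσ0.le
    linarith

variable [InnerProductSpace ℝ E]

/-- If `A` and `B` are separated up to `ε`, `A` is large against `ε` and is shrunk towards its
centre, and a point of `B` either stays or moves as it does when `B` is shrunk likewise, then it is
as far from the image of a point of `A` as the other points of the image of `A` are. -/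
lemma norm_le_norm_sub_of_shrink {N ε : ℝ} (hN : 2 ≤ N) (hε : 0 < ε) {A B : Set E}
    {c d x y z : E} {ρ s : ℝ} (hA : IsVarianceCenter (1 / N) A c ρ) (hρ : 600 * N ^ 2 * ε ≤ ρ)
    (hs : s = 0 ∨
      ∃ σ, IsVarianceCenter (1 / N) B d σ ∧ 600 * N ^ 2 * ε ≤ σ ∧ s = 16 * N * ε / σ)
    (hAB : ∀ x ∈ A, ∀ y ∈ A, ∀ z ∈ B, ‖x - y‖ ≤ ‖x - z‖ + ε)
    (hBA : ∀ x ∈ B, ∀ y ∈ B, ∀ z ∈ A, ‖x - y‖ ≤ ‖x - z‖ + ε)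
    (hx : x ∈ A) (hy : y ∈ A) (hz : z ∈ B) :
    (1 - 16 * N * ε / ρ) * ‖x - y‖ ≤
      ‖(x + (16 * N * ε / ρ) • (c - x)) - (z + s • (d - z))‖ := by
  have hN0 : 0 < N := by linarith
  have hMpos : 0 < 600 * N ^ 2 * ε := by positivity
  have hρ0 : 0 < ρ := hMpos.trans_le hρ
  set K := 16 * N * ε with hK
  have hK0 : 0 < K := by positivity
  have hKM : K ≤ 600 * N ^ 2 * ε := by rw [hK]; nlinarith [mul_pos hN0 hε]
  have hεK : ε ≤ K := by rw [hK]; nlinarith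
  set t := K / ρ with ht
  have ht0 : 0 < t := div_pos hK0 hρ0
  have ht1 : t ≤ 1 := by rw [ht, div_le_one hρ0]; linarith
  have htρ : t * ρ = K := by rw [ht]; field_simp
  have hs0 : 0 ≤ s := by
    rcases hs with rfl | ⟨σ, hB, hσ, rfl⟩
    · exact le_rfl
    · exact div_nonneg hK0.le hB.radius_nonneg
  have hmovex : ‖t • (c - x)‖ ≤ K := by
    rw [norm_smul, Real.norm_of_nonneg ht0.le, ← htρ, norm_sub_rev]
    exact mul_le_mul_of_nonneg_left (hA.norm_sub_le x hx) ht0.le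
  have hmovez : ‖s • (d - z)‖ ≤ K := by
    rcases hs with rfl | ⟨σ, hB, hσ, hsσ⟩
    · simpa using hK0.le
    · have hσ0 : 0 < σ := hMpos.trans_le hσ
      have : s * σ = K := by rw [hsσ]; field_simp
      rw [norm_smul, Real.norm_of_nonneg hs0, ← this, norm_sub_rev]
      exact mul_le_mul_of_nonneg_left (hB.norm_sub_le z hz) hs0
  set R := ‖x - z‖ with hR
  have hR0 : 0 ≤ R := norm_nonneg _
  have hdist : ‖x - y‖ ≤ R + ε := hAB x hx y hy z hz
  have hexpand : (x + t • (c - x)) - (z + s • (d - z)) = (x - z) + t • (c - x) - s • (d - z) := by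
    abel
  rw [hexpand]
  by_cases hfar : ‖x - y‖ + 2 * K ≤ R
  · have h1 : R ≤ ‖(x - z) + t • (c - x) - s • (d - z)‖ + ‖t • (c - x)‖ + ‖s • (d - z)‖ := by
      have h2 : x - z = ((x - z) + t • (c - x) - s • (d - z)) - t • (c - x) + s • (d - z) := by
        abel
      calc R = ‖((x - z) + t • (c - x) - s • (d - z)) - t • (c - x) + s • (d - z)‖ := by
            rw [← h2]
        _ ≤ _ := (norm_add_le _ _).trans (by gcongr; exact norm_sub_le _ _)
    nlinarith [mul_nonneg ht0.le (norm_nonneg (x - y))]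
  push Not at hfar
  have hxy : ‖x - y‖ ≤ 2 * ρ := by
    have h1 := norm_sub_le_norm_sub_add_norm_sub x c y
    have h2 := hA.norm_sub_le x hx
    have h3 := hA.norm_sub_le y hy
    rw [norm_sub_rev] at h3
    linarith
  have hR4 : R ≤ 4 * ρ := by linarith
  have hb : ‖x - c‖ ^ 2 + ρ ^ 2 ≤ (R + ε) ^ 2 :=
    hA.ge_of_forall_ge x _ fun y' hy' =>
      pow_le_pow_left₀ (norm_nonneg _) (hAB x hx y' hy' z hz) 2
  have ha : (1 + 1 / N) * ρ ^ 2 ≤ ‖z - c‖ ^ 2 + 4 * ε * ρ :=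
    hA.radius_sq_le z ε hε.le fun y hy y' hy' => by
      rw [norm_sub_rev z]; exact hAB y hy y' hy' z hz
  have hRpos : 0 < R := by
    have : ρ ^ 2 ≤ (R + ε) ^ 2 := by nlinarith [sq_nonneg ‖x - c‖]
    have := abs_le_of_sq_le_sq' this (by positivity) |>.2
    have : ε < ρ := by nlinarith
    linarith
  have hloss := loss_le hN hε hρ hs hBA hx hz hR4
    fun z' hz' => by linarith [hAB x hx y hy z' hz']
  have hgain := gain_sub_loss_ge hN hε hρ hR0 hR4 hb
    (pow_le_pow_left₀ (norm_nonneg _) (hA.norm_sub_le x hx) 2) ha hloss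
  -- Project the new difference on the old one.
  have hproj : ⟪x - z, (x - z) + t • (c - x) - s • (d - z)⟫ ≤
      R * ‖(x - z) + t • (c - x) - s • (d - z)‖ := real_inner_le_norm _ _
  have hxc : ‖z - c‖ ^ 2 = R ^ 2 + 2 * ⟪x - z, c - x⟫ + ‖x - c‖ ^ 2 := by
    rw [norm_sub_rev x c, hR, ← norm_add_sq_real, norm_sub_rev z c]
    congr 2; abel
  have hzd : ‖x - d‖ ^ 2 = R ^ 2 - 2 * ⟪x - z, d - z⟫ + ‖z - d‖ ^ 2 := by
    rw [norm_sub_rev z d, hR, ← norm_sub_sq_real]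
    congr 2; abel
  rw [inner_sub_right, inner_add_right, inner_smul_right, inner_smul_right,
    real_inner_self_eq_norm_sq, ← hR] at hproj
  have hfin : R * ((1 - t) * (R + ε)) ≤ R * ‖(x - z) + t • (c - x) - s • (d - z)‖ := by
    rw [hxc, hzd, ← hK, ← ht] at hgain
    nlinarith [mul_nonneg ht0.le (mul_nonneg hR0 hε.le)]
  exact (mul_le_mul_of_nonneg_left hdist (by linarith)).trans (le_of_mul_le_mul_left hfin hRpos)

end Shrinking

/-! ### The Triplet Loss and the distance from Triplet-Separation -/

section TripletLoss

variable {X Y : Type*} {n : ℕ} {h : X → Y} {f g : X → EuclideanSpace ℝ (Fin n)}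

lemma tripletLoss_le_toReal (hf : hardTripletLoss h f ≠ ⊤) {x xp xn : X} (hp : h x = h xp)
    (hn : h x ≠ h xn) : dist (f x) (f xp) ≤ dist (f x) (f xn) + (hardTripletLoss h f).toReal := by
  have h1 : ENNReal.ofReal (tripletLoss f x xp xn) ≤ hardTripletLoss h f :=
    le_iSup_of_le x <| le_iSup_of_le xp <| le_iSup_of_le xn <| le_iSup_of_le hp <|
      le_iSup_of_le hn le_rfl
  have h2 := (ENNReal.ofReal_le_iff_le_toReal hf).1 h1
  have h3 : dist (f x) (f xp) - dist (f x) (f xn) ≤ tripletLoss f x xp xn := le_max_left _ _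
  linarith

lemma dHaus_le_ofReal {δ : ℝ} (hfg : ∀ x, dist (f x) (g x) ≤ δ) :
    dHaus h f g ≤ ENNReal.ofReal δ := by
  refine iSup_le fun i => Metric.hausdorffEDist_le_of_mem_edist ?_ ?_
  · rintro _ ⟨x, hx, rfl⟩
    refine ⟨g x, ⟨x, hx, rfl⟩, ?_⟩
    rw [edist_dist]
    exact ENNReal.ofReal_le_ofReal (hfg x)
  · rintro _ ⟨x, hx, rfl⟩
    refine ⟨f x, ⟨x, hx, rfl⟩, ?_⟩
    rw [edist_comm, edist_dist]
    exact ENNReal.ofReal_le_ofReal (hfg x)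

lemma exists_dist_lt_of_dHaus_lt {r : ℝ} (hr : dHaus h f g < ENNReal.ofReal r) (x : X) :
    ∃ x', h x' = h x ∧ dist (f x) (g x') < r := by
  have h1 : Metric.hausdorffEDist (classImage h f (h x)) (classImage h g (h x)) <
      ENNReal.ofReal r :=
    (le_iSup (fun i => Metric.hausdorffEDist (classImage h f i) (classImage h g i)) _).trans_lt hr
  obtain ⟨_, ⟨x', hx', rfl⟩, hlt⟩ :=
    Metric.exists_edist_lt_of_hausdorffEDist_lt (show f x ∈ classImage h f (h x) from ⟨x, rfl, rfl⟩) h1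
  rw [edist_dist] at hlt
  exact ⟨x', hx', (ENNReal.ofReal_lt_ofReal_iff_of_nonneg dist_nonneg).1 hlt⟩

/-- Each of the two distances compared in a triplet changes by at most twice the Hausdorff-like
distance from a Triplet-Separated function. -/
lemma hardTripletLoss_le_four_mul_dHausTS : hardTripletLoss h f ≤ 4 * dHausTS h f := by
  unfold dHausTS
  simp only [ENNReal.mul_iInf_of_ne (a := 4) (by simp) (by simp)]
  refine le_iInf₂ fun g hg => ?_
  by_cases htop : dHaus h f g = ⊤
  · simp [htop]
  refine iSup_le fun x => iSup_le fun xp => iSup_le fun xn => iSup_le fun hp => iSup_le fun hn => ?_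
  have h4 : 4 * dHaus h f g = ENNReal.ofReal (4 * (dHaus h f g).toReal) := by
    rw [ENNReal.ofReal_mul (by norm_num), ENNReal.ofReal_toReal htop]
    norm_num
  rw [h4]
  refine ENNReal.ofReal_le_ofReal (max_le ?_ (by positivity))
  refine le_of_forall_pos_le_add fun r hr => ?_
  have hlt : dHaus h f g < ENNReal.ofReal ((dHaus h f g).toReal + r / 4) := by
    rw [ENNReal.lt_ofReal_iff_toReal_lt htop]
    linarith
  obtain ⟨u, hu, hdu⟩ := exists_dist_lt_of_dHaus_lt hlt x
  obtain ⟨up, hup, hdup⟩ := exists_dist_lt_of_dHaus_lt hlt xp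
  obtain ⟨un, hun, hdun⟩ := exists_dist_lt_of_dHaus_lt hlt xn
  have hsep := hg.2 (h x) (h xn) hn (g u) ⟨u, hu, rfl⟩ (g up) ⟨up, hup.trans hp.symm, rfl⟩ (g un)
    ⟨un, hun, rfl⟩
  have h1 := dist_triangle4 (f x) (g u) (g up) (f xp)
  have h2 := dist_triangle4 (g u) (f x) (f xn) (g un)
  rw [dist_comm (g u) (f x)] at h2
  rw [dist_comm (g up) (f xp)] at h1
  linarith

/-- How a class `A` is moved when the loss is `ε`: every point goes the fraction `s` of the way
towards `d`. A class of small radius collapses to one of its own points `d`, and a large one shrinks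
towards its variance centre `d` so that no point travels further than `16 * N * ε`. -/
def IsShrinking {E : Type*} [NormedAddCommGroup E] (N ε : ℝ) (A : Set E) (d : E) (s : ℝ) : Prop :=
  (s = 1 ∧ d ∈ A ∧ ∀ x ∈ A, ‖x - d‖ ≤ 1200 * N ^ 2 * ε) ∨
    ∃ ρ, IsVarianceCenter (1 / N) A d ρ ∧ 600 * N ^ 2 * ε ≤ ρ ∧ s = 16 * N * ε / ρ

lemma exists_isShrinking {E : Type*} [NormedAddCommGroup E] [InnerProductSpace ℝ E]
    [FiniteDimensional ℝ E] (ε : ℝ) {A : Set E} (hA : A.Nonempty) (hb : Bornology.IsBounded A) :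
    ∃ d s, IsShrinking (Module.finrank ℝ E + 2 : ℝ) ε A d s := by
  obtain ⟨c, ρ, hc⟩ := exists_isVarianceCenter hA hb
  by_cases hρ : 600 * (Module.finrank ℝ E + 2 : ℝ) ^ 2 * ε ≤ ρ
  · exact ⟨c, _, Or.inr ⟨ρ, hc, hρ, rfl⟩⟩
  · obtain ⟨d, hd⟩ := hA
    refine ⟨d, 1, Or.inl ⟨rfl, hd, fun x hx => ?_⟩⟩
    have h1 := norm_sub_le_norm_sub_add_norm_sub x c d
    have h2 := hc.norm_sub_le x hx
    have h3 := hc.norm_sub_le d hd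
    rw [norm_sub_rev] at h3
    linarith

lemma IsShrinking.norm_smul_le {E : Type*} [NormedAddCommGroup E] [InnerProductSpace ℝ E]
    {N ε s : ℝ} (hN : 2 ≤ N) (hε : 0 < ε) {A : Set E} {d x : E} (hs : IsShrinking N ε A d s)
    (hx : x ∈ A) : ‖s • (d - x)‖ ≤ 1200 * N ^ 2 * ε := by
  rcases hs with ⟨rfl, -, hA⟩ | ⟨ρ, hA, hρ, rfl⟩
  · rw [one_smul, norm_sub_rev]
    exact hA x hx
  · have hρ0 : 0 < ρ := lt_of_lt_of_le (by positivity) hρ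
    have hs0 : 0 ≤ 16 * N * ε / ρ := by positivity
    have h1 := mul_le_mul_of_nonneg_left (hA.norm_sub_le x hx) hs0
    rw [div_mul_cancel₀ _ hρ0.ne'] at h1
    rw [norm_smul, Real.norm_of_nonneg hs0, norm_sub_rev]
    nlinarith [mul_pos (show 0 < N by linarith) hε]

/-- Moving two classes that are separated up to `ε` makes them separated. -/
lemma IsShrinking.norm_sub_le_norm_sub {E : Type*} [NormedAddCommGroup E] [InnerProductSpace ℝ E]
    {N ε s t : ℝ} (hN : 2 ≤ N) (hε : 0 < ε) {A B : Set E} {c d x y z : E}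
    (ht : IsShrinking N ε A c t) (hs : IsShrinking N ε B d s)
    (hAB : ∀ x ∈ A, ∀ y ∈ A, ∀ z ∈ B, ‖x - y‖ ≤ ‖x - z‖ + ε)
    (hBA : ∀ x ∈ B, ∀ y ∈ B, ∀ z ∈ A, ‖x - y‖ ≤ ‖x - z‖ + ε)
    (hx : x ∈ A) (hy : y ∈ A) (hz : z ∈ B) :
    ‖(x + t • (c - x)) - (y + t • (c - y))‖ ≤ ‖(x + t • (c - x)) - (z + s • (d - z))‖ := by
  rcases ht with ⟨rfl, -, -⟩ | ⟨ρ, hA, hρ, rfl⟩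
  · simp
  have hρ0 : 0 < ρ := lt_of_lt_of_le (by positivity) hρ
  have ht1 : 16 * N * ε / ρ ≤ 1 := by
    rw [div_le_one hρ0]
    nlinarith [mul_pos (show 0 < N by linarith) hε]
  have hxy : (x + (16 * N * ε / ρ) • (c - x)) - (y + (16 * N * ε / ρ) • (c - y)) =
      (1 - 16 * N * ε / ρ) • (x - y) := by module
  rw [hxy, norm_smul, Real.norm_of_nonneg (by linarith)]
  rcases hs with ⟨rfl, hd, -⟩ | hs
  · -- A collapsed class is a point of the original class that stays where it is.
    have := norm_le_norm_sub_of_shrink hN hε (s := 0) (d := d) hA hρ (Or.inl rfl) hAB hBA hx hy hd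
    simpa using this
  · exact norm_le_norm_sub_of_shrink hN hε hA hρ (Or.inr hs) hAB hBA hx hy hz

lemma dHausTS_le_mul_hardTripletLoss (hh : Function.Surjective h)
    (hb : Bornology.IsBounded (Set.range f)) :
    dHausTS h f ≤ ENNReal.ofReal (1200 * (n + 2 : ℝ) ^ 2) * hardTripletLoss h f := by
  by_cases htop : hardTripletLoss h f = ⊤
  · rw [htop, ENNReal.mul_top (by rw [Ne, ENNReal.ofReal_eq_zero, not_le]; positivity)]
    exact le_top
  have hne : ∀ g : X → EuclideanSpace ℝ (Fin n), ∀ i, (classImage h g i).Nonempty := by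
    intro g i
    obtain ⟨x, hx⟩ := hh i
    exact ⟨g x, x, hx, rfl⟩
  have htrip : ∀ i j, i ≠ j → ∀ x ∈ classImage h f i, ∀ y ∈ classImage h f i,
      ∀ z ∈ classImage h f j, ‖x - y‖ ≤ ‖x - z‖ + (hardTripletLoss h f).toReal := by
    rintro i j hij _ ⟨x, rfl, rfl⟩ _ ⟨y, hy, rfl⟩ _ ⟨z, rfl, rfl⟩
    rw [← dist_eq_norm, ← dist_eq_norm]
    exact tripletLoss_le_toReal htop hy.symm hij
  set ε := (hardTripletLoss h f).toReal with hεdef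
  rcases (ENNReal.toReal_nonneg : 0 ≤ ε).eq_or_lt with hε0 | hε
  · have hf : f ∈ tripletSeparatedFunctions h n := by
      refine ⟨hne f, fun i j hij x hx y hy z hz => ?_⟩
      have := htrip i j hij x hx y hy z hz
      rw [dist_eq_norm, dist_eq_norm]
      linarith
    refine (iInf₂_le f hf).trans (le_trans ?_ (zero_le))
    have := dHaus_le_ofReal (h := h) (f := f) (g := f) (δ := 0) (by simp)
    simpa using this
  have hbi : ∀ i, Bornology.IsBounded (classImage h f i) := fun i =>
    hb.subset (by rintro _ ⟨x, -, rfl⟩; exact ⟨x, rfl⟩)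
  choose d s hs using fun i => exists_isShrinking ε (hne f i) (hbi i)
  simp only [finrank_euclideanSpace, Fintype.card_fin] at hs
  have hN : (2 : ℝ) ≤ (n : ℝ) + 2 := by linarith [(Nat.cast_nonneg n : (0 : ℝ) ≤ n)]
  have hmem : ∀ x, f x ∈ classImage h f (h x) := fun x => ⟨x, rfl, rfl⟩
  set g : X → EuclideanSpace ℝ (Fin n) := fun x => f x + s (h x) • (d (h x) - f x) with hg
  have hgTS : g ∈ tripletSeparatedFunctions h n := by
    refine ⟨hne g, ?_⟩
    rintro i j hij _ ⟨x, rfl, rfl⟩ _ ⟨y, hy, rfl⟩ _ ⟨z, rfl, rfl⟩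
    rw [dist_eq_norm, dist_eq_norm]
    simp only [hg, hy]
    exact (hs (h x)).norm_sub_le_norm_sub hN hε (hs (h z)) (htrip _ _ hij) (htrip _ _ hij.symm)
      (hmem x) (hy ▸ hmem y) (hmem z)
  have hclose : ∀ x, dist (f x) (g x) ≤ 1200 * (n + 2 : ℝ) ^ 2 * ε := by
    intro x
    rw [dist_comm, dist_eq_norm, hg, add_sub_cancel_left]
    exact (hs (h x)).norm_smul_le hN hε (hmem x)
  refine (iInf₂_le g hgTS).trans ((dHaus_le_ofReal hclose).trans ?_)
  rw [ENNReal.ofReal_mul (by positivity), hεdef, ENNReal.ofReal_toReal htop]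

end TripletLoss

theorem corollary1 (n : ℕ) (θ : ℝ) (hθ : 0 < θ) :
    ∃ C : ℝ≥0, 0 < C ∧
      ∀ (X : Type*) (Y : Type*) [Finite Y] (h : X → Y), Function.Surjective h →
        -- the two objectives bound each other within a constant factor
        (∀ f ∈ thickEmbeddings X n θ,
          hardTripletLoss h f ≤ C * dHausTS h f ∧ dHausTS h f ≤ C * hardTripletLoss h f) ∧
        -- the optima over any family of such embeddings agree within a constant factor
        (∀ F ⊆ thickEmbeddings X n θ,
          ((⨅ g ∈ F, hardTripletLoss h g) ≤ C * ⨅ g ∈ F, dHausTS h g) ∧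
          ((⨅ g ∈ F, dHausTS h g) ≤ C * ⨅ g ∈ F, hardTripletLoss h g) ∧
          (∀ f ∈ F, IsMinOn (hardTripletLoss h) F f →
            dHausTS h f ≤ C * ⨅ g ∈ F, dHausTS h g) ∧
          (∀ f ∈ F, IsMinOn (dHausTS h) F f →
            hardTripletLoss h f ≤ C * ⨅ g ∈ F, hardTripletLoss h g)) := by
  set c : ℝ≥0 := Real.toNNReal (1200 * (n + 2 : ℝ) ^ 2) with hc
  have hc4 : 4 ≤ c := by
    rw [hc, ← NNReal.coe_le_coe, Real.coe_toNNReal _ (by positivity)]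
    push_cast
    nlinarith [(Nat.cast_nonneg n : (0 : ℝ) ≤ n)]
  have hc1 : 1 ≤ c := le_trans (by norm_num) hc4
  have hcc : c ≤ c * c := le_mul_of_one_le_left (zero_le) hc1
  have hcpos : 0 < c * c := lt_of_lt_of_le (lt_of_lt_of_le one_pos hc1) hcc
  -- A minimizer of one objective is compared with the other one through two estimates, whence the
  -- square.
  refine ⟨c * c, hcpos, fun X Y _ h hh => ?_⟩
  have hL : ∀ f : X → EuclideanSpace ℝ (Fin n), hardTripletLoss h f ≤ c * dHausTS h f := fun f =>
    hardTripletLoss_le_four_mul_dHausTS.trans (by gcongr; exact_mod_cast hc4)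
  have hd : ∀ f ∈ thickEmbeddings X n θ, dHausTS h f ≤ c * hardTripletLoss h f := fun f hf =>
    dHausTS_le_mul_hardTripletLoss hh hf.1
  have hcc' : ∀ a : ℝ≥0∞, (c : ℝ≥0∞) * a ≤ ((c * c : ℝ≥0) : ℝ≥0∞) * a := fun a => by
    gcongr
  have h0 : ((c * c : ℝ≥0) : ℝ≥0∞) ≠ 0 := by exact_mod_cast hcpos.ne'
  have hsq : ∀ a : ℝ≥0∞, ((c * c : ℝ≥0) : ℝ≥0∞) * a = c * (c * a) := fun a => by
    rw [ENNReal.coe_mul, mul_assoc]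
  refine ⟨fun f hf => ⟨(hL f).trans (hcc' _), (hd f hf).trans (hcc' _)⟩, fun F hF => ?_⟩
  simp only [ENNReal.mul_iInf_of_ne h0 ENNReal.coe_ne_top]
  refine ⟨le_iInf₂ fun g hg => (iInf₂_le g hg).trans ((hL g).trans (hcc' _)),
    le_iInf₂ fun g hg => (iInf₂_le g hg).trans ((hd g (hF hg)).trans (hcc' _)),
    fun f hf hmin => le_iInf₂ fun g hg => ?_, fun f hf hmin => le_iInf₂ fun g hg => ?_⟩
  · rw [hsq]
    refine (hd f (hF hf)).trans ?_
    gcongr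
    exact (hmin hg).trans (hL g)
  · rw [hsq]
    refine (hL f).trans ?_
    gcongr
    exact (hmin hg).trans (hd g (hF hg))
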